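/- Let $\mathbb K\in\{\mathbb R,\mathbb C\}$, let $E$ be a quasi-complete locally convex Hausdorff space over $\mathbb K$ (every closed bounded subset of $E$ is complete) with topological dual $E'$, let $d\in\mathbb N$ and $k,n\in\mathbb N_0\cup\{\infty\}$. A function $u\colon\mathbb R^d\to E$ is $\mathcal C^0$ if it is continuous, and $\mathcal C^1$ if for each $1\le j\le d$ the partial derivative $\partial^{e_j}u(x)=\lim_{h\to0,\,0\neq h\in\mathbb R}\frac{u(x+he_j)-u(x)}{h}$ exists in $E$ for every $x\in\mathbb R^d$ and $\partial^{e_j}u$ is continuous. For $m\geq 2$ it is $\mathcal C^{m}$ if it is $\mathcal C^1$ and all $\partial^{e_j}u$ are $\mathcal C^{m-1}$, and it is $\mathcal C^\infty$ if it is $\mathcal C^m$ for all $m\in\mathbb N$. Write $\mathcal C^k(\mathbb R^d,E)$ for the space of these functions, $\mathcal C^k(\mathbb R^d)=\mathcal C^k(\mathbb R^d,\mathbb K)$, $\partial^\beta u=(\partial^{e_1})^{\beta_1}\cdots(\partial^{e_d})^{\beta_d}u$ for $\beta\in\mathbb N_0^d$ with $|\beta|=\beta_1+\dots+\beta_d$,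 and $\operatorname{supp}u=\overline{\{x: u(x)\neq0\}}$. A function $h\colon\mathbb R^d\to E$ is Pettis-integrable on a Lebesgue measurable set $\Lambda\subset\mathbb R^d$ if $e'\circ h$ is Lebesgue measurable and integrable over $\Lambda$ for every $e'\in E'$, and there is $e_\Lambda\in E$ such that $e'(e_\Lambda)=\int_\Lambda e'(h(y))\,dy$ for all $e'\in E'$. The vector $e_\Lambda$ is then unique, and $\int_\Lambda h(y)\,dy:=e_\Lambda$. Let $f\in\mathcal C^k(\mathbb R^d,E)$ and $g\in\mathcal C^n(\mathbb R^d)$, and suppose that at least one of $f$, $g$ has compact support. Consider $$(f*g)(x):=\int_{\mathbb R^d}f(y)g(x-y)\,dy,\qquad (g*f)(x):=\int_{\mathbb R^d}g(y)f(x-y)\,dy,\qquad x\in\mathbb R^d.$$ Then: 1. $f*g$ and $g*f$ are well defined: for every $x\in\mathbb R^d$ the functions $y\mapsto f(y)g(x-y)$ and $y\mapsto g(y)f(x-y)$ are Pettis-integrable on every Lebesgue measurable subset of $\mathbb R^d$. 2. $\operatorname{supp}(f*g)\subset\operatorname{supp}f+\operatorname{supp}g$. 3. $f*g=g*f$. 4.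 $f*g\in\mathcal C^n(\mathbb R^d,E)$. 5. For every $\beta\in\mathbb N_0^d$ with $|\beta|\le n$, the convolution $f*(\partial^\beta g)$ is well defined in the same sense and $\partial^\beta(f*g)=f*(\partial^\beta g)$. 6. For every $\beta\in\mathbb N_0^d$ with $|\beta|\le\min(k,n)$, the convolution $(\partial^\beta f)*g$ is well defined in the same sense and $\partial^\beta(f*g)=(\partial^\beta f)*g$. -/

import Mathlib

open MeasureTheory Filter Topology
open scoped Pointwise

noncomputable section

namespace PettisConv

/-! ### Continuously partially differentiable functions on `ℝ^d` with values in a topological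
vector space -/

section Differentiation

variable (𝕜 : Type*) [RCLike 𝕜] {E : Type*} [AddCommGroup E] [Module 𝕜 E] [TopologicalSpace E]
  {d : ℕ}

/-- `l` is the limit of `(f (x + h e_j) - f x) / h` as the real number `h ≠ 0` tends to `0`. -/
def HasPartialDerivAt (j : Fin d) (f : EuclideanSpace ℝ (Fin d) → E) (l : E)
    (x : EuclideanSpace ℝ (Fin d)) : Prop :=
  Tendsto (fun h : ℝ => ((h : 𝕜)⁻¹) • (f (x + h • EuclideanSpace.single j (1 : ℝ)) - f x))
    (𝓝[≠] (0 : ℝ)) (𝓝 l)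

open Classical in
/-- The `j`-th partial derivative `∂^{e_j} f` (with value `0` where the limit does not exist). -/
def partialDeriv (j : Fin d) (f : EuclideanSpace ℝ (Fin d) → E) :
    EuclideanSpace ℝ (Fin d) → E :=
  fun x => if h : ∃ l, HasPartialDerivAt 𝕜 j f l x then h.choose else 0

/-- `f` is `𝓒^m` for a natural number `m`: `𝓒^0` means continuous; `𝓒^(m+1)` means that all first
partial derivatives exist everywhere, are continuous, and are themselves `𝓒^m`. -/
def IsCNat : ℕ → (EuclideanSpace ℝ (Fin d) → E) → Prop
  | 0, f => Continuous f
  | m + 1, f => (∀ j x, ∃ l, HasPartialDerivAt 𝕜 j f l x) ∧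
      ∀ j, Continuous (partialDeriv 𝕜 j f) ∧ IsCNat m (partialDeriv 𝕜 j f)

/-- `f ∈ 𝓒^k(ℝ^d, E)` for `k ∈ ℕ₀ ∪ {∞}`. -/
def IsC (k : ℕ∞) (f : EuclideanSpace ℝ (Fin d) → E) : Prop :=
  ∀ m : ℕ, (m : ℕ∞) ≤ k → IsCNat 𝕜 m f

/-- `∂^β f = ∂^{β_1} ⋯ ∂^{β_d} f`, where `∂^{β_j}` is the `β_j`-th iterate of the `j`-th partial
derivative. -/
def multiDeriv (β : Fin d → ℕ) (f : EuclideanSpace ℝ (Fin d) → E) :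
    EuclideanSpace ℝ (Fin d) → E :=
  (List.finRange d).foldr (fun j F => (partialDeriv 𝕜 j)^[β j] F) f

end Differentiation

/-! ### The Pettis integral -/

section Pettis

variable (𝕜 : Type*) [RCLike 𝕜] {E : Type*} [AddCommGroup E] [Module 𝕜 E] [TopologicalSpace E]
  {X : Type*} [MeasurableSpace X]

/-- `e' ∘ f` is measurable with respect to the `μ`-completed σ-algebra for all `e' ∈ E'`.
For the Lebesgue measure on `ℝ^d` the completed σ-algebra is that of the Lebesgue measurable
sets. -/
def WeaklyMeasurable (μ : Measure X) (f : X → E) : Prop :=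
  ∀ e' : StrongDual 𝕜 E, NullMeasurable (fun x => e' (f x)) μ

/-- `f` is Pettis integrable on `Λ`: it is weakly measurable, weakly integrable on `Λ`, and there is
`e ∈ E` with `⟨e', e⟩ = ∫_Λ ⟨e', f⟩ dμ` for all `e' ∈ E'`. -/
def PettisIntegrableOn (μ : Measure X) (Λ : Set X) (f : X → E) : Prop :=
  WeaklyMeasurable 𝕜 μ f ∧
  (∀ e' : StrongDual 𝕜 E, IntegrableOn (fun x => e' (f x)) Λ μ) ∧
  ∃ e : E, ∀ e' : StrongDual 𝕜 E, e' e = ∫ x in Λ, e' (f x) ∂μ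

/-- `f` is Pettis integrable on the whole (completed) σ-algebra. -/
def PettisIntegrable (μ : Measure X) (f : X → E) : Prop :=
  ∀ Λ : Set X, NullMeasurableSet Λ μ → PettisIntegrableOn 𝕜 μ Λ f

open Classical in
/-- The Pettis integral `∫_Λ f dμ ∈ E` (with value `0` if `f` is not Pettis integrable on `Λ`). -/
def pettisIntegral (μ : Measure X) (Λ : Set X) (f : X → E) : E :=
  if h : PettisIntegrableOn 𝕜 μ Λ f then h.2.2.choose else 0

/-- In a locally convex Hausdorff space, the Pettis integral is the only vector with the defining
property. -/
theorem pettisIntegral_eq [IsTopologicalAddGroup E] [ContinuousSMul 𝕜 E] [T2Space E]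
    [PolynormableSpace 𝕜 E] {μ : Measure X} {Λ : Set X} {f : X → E}
    (hf : PettisIntegrableOn 𝕜 μ Λ f) {e : E}
    (he : ∀ e' : StrongDual 𝕜 E, e' e = ∫ x in Λ, e' (f x) ∂μ) :
    pettisIntegral 𝕜 μ Λ f = e := by
  by_contra hne
  have h1 : ∀ e' : StrongDual 𝕜 E, e' (pettisIntegral 𝕜 μ Λ f) = e' e := by
    intro e'
    rw [pettisIntegral, dif_pos hf, hf.2.2.choose_spec e', he e']
  have hx : pettisIntegral 𝕜 μ Λ f - e ≠ 0 := sub_ne_zero.mpr hne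
  obtain ⟨g, hg⟩ := StrongDual.exists_extension (Submodule.span 𝕜 {pettisIntegral 𝕜 μ Λ f - e})
    (LinearMap.toContinuousLinearMap
      (LinearEquiv.toSpanNonzeroSingleton 𝕜 E _ hx).symm.toLinearMap)
  have h2 := hg ⟨_, Submodule.mem_span_singleton_self _⟩
  have h3 := LinearEquiv.coord_self 𝕜 E _ hx
  simp only [LinearEquiv.coord] at h3
  have h4 : g (pettisIntegral 𝕜 μ Λ f - e) = 1 := h2.trans h3
  rw [map_sub, h1 g, sub_self] at h4
  exact zero_ne_one h4

end Pettis

/-! ### Convolution -/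

section Convolution

variable (𝕜 : Type*) [RCLike 𝕜] {E : Type*} [AddCommGroup E] [Module 𝕜 E] [TopologicalSpace E]
  {d : ℕ}

/-- The integrand `y ↦ f(y) g(x - y)` of `(f ∗ g)(x)`, `f` vector-valued and `g` scalar-valued. -/
def integrandVS (f : EuclideanSpace ℝ (Fin d) → E) (g : EuclideanSpace ℝ (Fin d) → 𝕜)
    (x : EuclideanSpace ℝ (Fin d)) : EuclideanSpace ℝ (Fin d) → E :=
  fun y => g (x - y) • f y

/-- The integrand `y ↦ g(y) f(x - y)` of `(g ∗ f)(x)`, `g` scalar-valued and `f` vector-valued. -/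
def integrandSV (g : EuclideanSpace ℝ (Fin d) → 𝕜) (f : EuclideanSpace ℝ (Fin d) → E)
    (x : EuclideanSpace ℝ (Fin d)) : EuclideanSpace ℝ (Fin d) → E :=
  fun y => g y • f (x - y)

/-- `f ∗ g` is well defined: for every `x`, `y ↦ f(y) g(x - y)` is Pettis integrable on every
Lebesgue measurable set. -/
def ConvVSExists (f : EuclideanSpace ℝ (Fin d) → E) (g : EuclideanSpace ℝ (Fin d) → 𝕜) : Prop :=
  ∀ x, PettisIntegrable 𝕜 volume (integrandVS 𝕜 f g x)

/-- `g ∗ f` is well defined: for every `x`, `y ↦ g(y) f(x - y)` is Pettis integrable on every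
Lebesgue measurable set. -/
def ConvSVExists (g : EuclideanSpace ℝ (Fin d) → 𝕜) (f : EuclideanSpace ℝ (Fin d) → E) : Prop :=
  ∀ x, PettisIntegrable 𝕜 volume (integrandSV 𝕜 g f x)

/-- `(f ∗ g)(x) = ∫ f(y) g(x - y) dy`. -/
def convVS (f : EuclideanSpace ℝ (Fin d) → E) (g : EuclideanSpace ℝ (Fin d) → 𝕜) :
    EuclideanSpace ℝ (Fin d) → E :=
  fun x => pettisIntegral 𝕜 volume Set.univ (integrandVS 𝕜 f g x)

/-- `(g ∗ f)(x) = ∫ g(y) f(x - y) dy`. -/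
def convSV (g : EuclideanSpace ℝ (Fin d) → 𝕜) (f : EuclideanSpace ℝ (Fin d) → E) :
    EuclideanSpace ℝ (Fin d) → E :=
  fun x => pettisIntegral 𝕜 volume Set.univ (integrandSV 𝕜 g f x)

end Convolution

end PettisConv

end

/-! For fixed `x` the integrand is continuous and vanishes off a compact set, so everything reduces
to weak integrals of continuous compactly supported functions.

Such an integral exists (`exists_isWeakIntegral`) as the limit of integrals of finitely valued
approximants. By Hahn-Banach, scalar estimates give `p e ≤ ∫ φ` whenever `p ∘ h ≤ φ` almost
everywhere (`IsWeakIntegral.seminorm_le`). This makes the finite sums Cauchy, and quasi-completeness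
supplies the limit.

The same estimate turns uniform convergence on a common compact set into convergence of integrals
(`IsWeakIntegral.tendsto`). Hence `f ∗ g` is continuous; a mean value inequality for seminorms,
again via functionals, allows differentiation under the integral, with derivatives falling on `g`.
The reflection `y ↦ x - y` gives `f ∗ g = g ∗ f`, and differentiating `g ∗ f` puts the derivatives
on `f`. -/

namespace PettisConv

/-! ### Weak integrals: seminorm estimate, convergence, existence. -/

section WeakIntegral

variable {𝕜 : Type*} [RCLike 𝕜] {E : Type*} [AddCommGroup E] [Module 𝕜 E]

/-- The Hahn-Banach theorem in the form of a norm formula: a bound on all functionals dominated by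
a continuous seminorm is a bound on the seminorm. -/
theorem seminorm_le_of_forall_dual [TopologicalSpace E] [PolynormableSpace 𝕜 E]
    {p : Seminorm 𝕜 E} (hp : Continuous p) {x : E} {c : ℝ}
    (h : ∀ e' : StrongDual 𝕜 E, (∀ y, ‖e' y‖ ≤ p y) → ‖e' x‖ ≤ c) : p x ≤ c := by
  by_cases hx : x = 0
  · subst hx
    simpa using h 0 (fun y => by simp)
  -- The functional on the line through `x` with `u x = p x`; its extension dominated by `p` attains
  -- `p x` at `x`.
  let u : Module.Dual 𝕜 (Submodule.span 𝕜 {x}) :=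
    ((p x : ℝ) : 𝕜) • (LinearEquiv.coord 𝕜 E x hx : _ →ₗ[𝕜] 𝕜)
  have hux : u ⟨x, Submodule.mem_span_singleton_self x⟩ = (p x : 𝕜) := by
    simp [u, LinearEquiv.coord_self, RCLike.real_smul_eq_coe_mul]
  have hu : ∀ y, ‖u y‖ ≤ p y := by
    intro y
    obtain ⟨a, ha⟩ := Submodule.mem_span_singleton.mp y.2
    have hy : y = a • (⟨x, Submodule.mem_span_singleton_self x⟩ : Submodule.span 𝕜 {x}) :=
      Subtype.ext ha.symm
    rw [hy, map_smul]
    rw [hux]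
    simp [map_smul_eq_mul, abs_of_nonneg (apply_nonneg p x)]
  obtain ⟨e', he', hle⟩ := Module.Dual.exists_continuous_extension_of_le_seminorm _ u hp hu
  have h1 := he' ⟨x, Submodule.mem_span_singleton_self x⟩
  have h3 := h e' hle
  rw [show e' x = (p x : 𝕜) from h1.trans hux] at h3
  simpa [abs_of_nonneg (apply_nonneg p x)] using h3

variable {X : Type*} [MeasurableSpace X]

/-- `e` is a weak integral of `h` with respect to `ν`. -/
def IsWeakIntegral (𝕜 : Type*) [RCLike 𝕜] {E : Type*} [AddCommGroup E] [Module 𝕜 E]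
    [TopologicalSpace E] (ν : Measure X) (h : X → E) (e : E) : Prop :=
  ∀ e' : StrongDual 𝕜 E, Integrable (fun y => e' (h y)) ν ∧ e' e = ∫ y, e' (h y) ∂ν

namespace IsWeakIntegral

variable [TopologicalSpace E] {ν : Measure X} {h h₁ h₂ : X → E} {e e₁ e₂ : E}

theorem sub (H₁ : IsWeakIntegral 𝕜 ν h₁ e₁) (H₂ : IsWeakIntegral 𝕜 ν h₂ e₂) :
    IsWeakIntegral 𝕜 ν (fun y => h₁ y - h₂ y) (e₁ - e₂) := by
  intro e'
  simp only [map_sub]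
  exact ⟨(H₁ e').1.sub (H₂ e').1, by
    rw [integral_sub (H₁ e').1 (H₂ e').1, (H₁ e').2, (H₂ e').2]⟩

theorem const_smul (c : 𝕜) (H : IsWeakIntegral 𝕜 ν h e) :
    IsWeakIntegral 𝕜 ν (fun y => c • h y) (c • e) := by
  intro e'
  simp only [map_smul, smul_eq_mul]
  exact ⟨(H e').1.const_mul c, by rw [integral_const_mul, (H e').2]⟩

/-- Each functional dominated by `p` is bounded at `e` by `∫ φ`, and these functionals determine `p
e`. The majorant `φ` is separate because `p ∘ h` need not be measurable here. -/
theorem seminorm_le [PolynormableSpace 𝕜 E] (H : IsWeakIntegral 𝕜 ν h e) {p : Seminorm 𝕜 E}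
    (hp : Continuous p) {φ : X → ℝ} (hφ : Integrable φ ν) (hle : ∀ᵐ y ∂ν, p (h y) ≤ φ y) :
    p e ≤ ∫ y, φ y ∂ν := by
  refine seminorm_le_of_forall_dual hp fun e' he' => ?_
  rw [(H e').2]
  exact norm_integral_le_of_norm_le hφ (hle.mono fun y hy => (he' _).trans hy)

theorem restrict (H : IsWeakIntegral 𝕜 ν h e) {K : Set X} (hK : ∀ y ∉ K, h y = 0) :
    IsWeakIntegral 𝕜 (ν.restrict K) h e := fun e' => ⟨(H e').1.restrict, by
  rw [setIntegral_eq_integral_of_forall_compl_eq_zero fun y hy => by rw [hK y hy, map_zero],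
    (H e').2]⟩

theorem of_restrict {K : Set X} (H : IsWeakIntegral 𝕜 (ν.restrict K) h e)
    (hK : ∀ y ∉ K, h y = 0) : IsWeakIntegral 𝕜 ν h e := fun e' => by
  have h0 : ∀ y ∉ K, e' (h y) = 0 := fun y hy => by rw [hK y hy, map_zero]
  refine ⟨IntegrableOn.integrable_of_forall_notMem_eq_zero (H e').1 h0, ?_⟩
  rw [← setIntegral_eq_integral_of_forall_compl_eq_zero h0, (H e').2]

/-- Weak integrals of functions supported in a set of finite measure converge if the functions
converge uniformly on that set. -/
theorem tendsto [PolynormableSpace 𝕜 E] {Z : Type*} {l : Filter Z} {G : Z → X → E} {I : Z → E}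
    (HG : ∀ z, IsWeakIntegral 𝕜 ν (G z) (I z)) (H : IsWeakIntegral 𝕜 ν h e) {K : Set X}
    (hKfin : ν K ≠ ⊤) (hKm : MeasurableSet K) (hG0 : ∀ᶠ z in l, ∀ y ∉ K, G z y = 0)
    (h0 : ∀ y ∉ K, h y = 0)
    (hlim : ∀ p : Seminorm 𝕜 E, Continuous p → ∀ ε > 0, ∀ᶠ z in l, ∀ y ∈ K, p (G z y - h y) ≤ ε) :
    Tendsto I l (𝓝 e) := by
  rw [(PolynormableSpace.withSeminorms 𝕜 E).tendsto_nhds]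
  rintro ⟨p, hp⟩ ε hε
  have : IsFiniteMeasure (ν.restrict K) := isFiniteMeasure_restrict.mpr hKfin
  -- The `+ 1` keeps the divisor positive when `K` is a null set.
  have hpos : 0 < ν.real K + 1 := by positivity
  filter_upwards [hG0, hlim p hp (ε / (ν.real K + 1)) (by positivity)] with z hz0 hz
  have h1 := (((HG z).sub H).restrict (K := K) fun y hy => by
    rw [hz0 y hy, h0 y hy, sub_zero]).seminorm_le hp
    (integrable_const (ε / (ν.real K + 1))) (ae_restrict_of_forall_mem hKm hz)
  refine h1.trans_lt ?_
  rw [integral_const, smul_eq_mul, measureReal_restrict_apply_univ, mul_div_assoc',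
    div_lt_iff₀ hpos]
  nlinarith [measureReal_nonneg (μ := ν) (s := K)]

end IsWeakIntegral

/-- Weak integrals of functions with finitely many values. -/
theorem isWeakIntegral_simpleFunc [TopologicalSpace E] {Y : Type*} (ν : Measure X)
    [IsFiniteMeasure ν] (φ : SimpleFunc X Y) (h : Y → E) :
    IsWeakIntegral 𝕜 ν (fun y => h (φ y))
      (∑ v ∈ φ.range, ((ν.real (φ ⁻¹' {v}) : ℝ) : 𝕜) • h v) := by
  intro e'
  have key : (fun y => e' (h (φ y))) =
      fun y => ∑ v ∈ φ.range, (φ ⁻¹' {v}).indicator (fun _ => e' (h v)) y := by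
    funext y
    rw [Finset.sum_eq_single (φ y)]
    · simp
    · intro v _ hv
      exact Set.indicator_of_notMem (fun hy => hv hy.symm) _
    · intro hy
      exact absurd (SimpleFunc.mem_range_self φ y) hy
  have hint : ∀ v ∈ φ.range, Integrable ((φ ⁻¹' {v}).indicator (fun _ => e' (h v))) ν :=
    fun v _ => (integrable_const _).indicator (φ.measurableSet_preimage _)
  rw [key]
  refine ⟨integrable_finsetSum _ hint, ?_⟩
  rw [integral_finsetSum _ hint, map_sum]
  refine Finset.sum_congr rfl fun v _ => ?_
  rw [integral_indicator_const _ (φ.measurableSet_preimage _), map_smul, smul_eq_mul,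
    RCLike.real_smul_eq_coe_mul]

variable [UniformSpace E] [IsUniformAddGroup E] [ContinuousSMul 𝕜 E]

variable (𝕜) in
/-- Quasi-complete spaces are sequentially complete. -/
theorem exists_tendsto_of_cauchySeq [QuasiCompleteSpace 𝕜 E] {u : ℕ → E} (hu : CauchySeq u) :
    ∃ e, Tendsto u atTop (𝓝 e) := by
  have hc : IsCompact (closure (Set.range u)) :=
    isCompact_closure_of_totallyBounded_quasiComplete (𝕜 := 𝕜) hu.totallyBounded_range
  obtain ⟨e, -, he⟩ := cauchySeq_tendsto_of_isComplete hc.isComplete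
    (fun n => subset_closure (Set.mem_range_self n)) hu
  exact ⟨e, he⟩

/-- A continuous function with compact support has a weak integral. -/
theorem exists_isWeakIntegral [PolynormableSpace 𝕜 E] [QuasiCompleteSpace 𝕜 E] {X : Type*} [MetricSpace X]
    [SecondCountableTopology X] [MeasurableSpace X] [BorelSpace X] {ν : Measure X}
    [IsFiniteMeasureOnCompacts ν] {h : X → E} (hh : Continuous h) {K : Set X} (hK : IsCompact K)
    (h0 : ∀ y ∉ K, h y = 0) : ∃ e, IsWeakIntegral 𝕜 ν h e := by
  suffices H : ∃ e, IsWeakIntegral 𝕜 (ν.restrict K) h e by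
    obtain ⟨e, he⟩ := H
    exact ⟨e, he.of_restrict h0⟩
  rcases K.eq_empty_or_nonempty with rfl | ⟨x₀, hx₀⟩
  · exact ⟨0, fun e' => by simp⟩
  have : IsFiniteMeasure (ν.restrict K) := isFiniteMeasure_restrict.mpr hK.measure_lt_top.ne
  set μ := ν.restrict K
  -- Finitely valued maps into `K` approximating the identity on `K`, so that `h ∘ φ n` tends to `h`
  -- there and `S n` below are Riemann-type sums.
  let φ : ℕ → SimpleFunc X X := SimpleFunc.approxOn id measurable_id K x₀ hx₀
  have hφK : ∀ n y, φ n y ∈ K := SimpleFunc.approxOn_mem measurable_id hx₀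
  have hφlim : ∀ᵐ y ∂μ, Tendsto (fun n => φ n y) atTop (𝓝 y) := by
    refine ae_restrict_of_forall_mem hK.measurableSet fun y hy => ?_
    exact SimpleFunc.tendsto_approxOn measurable_id hx₀ (subset_closure hy)
  set S : ℕ → E := fun n => ∑ v ∈ (φ n).range, ((μ.real (φ n ⁻¹' {v}) : ℝ) : 𝕜) • h v with hS_def
  have hS : ∀ n, IsWeakIntegral 𝕜 μ (fun y => h (φ n y)) (S n) := fun n =>
    isWeakIntegral_simpleFunc μ (φ n) h
  have hpint : ∀ p : Seminorm 𝕜 E, Continuous p → ∃ M : ℝ, ∀ y ∈ K, p (h y) ≤ M := fun p hp => by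
    obtain ⟨M, hM⟩ := (hK.image (hp.comp hh)).bddAbove
    exact ⟨M, fun y hy => hM ⟨y, hy, rfl⟩⟩
  have hpS : ∀ p : Seminorm 𝕜 E, Continuous p →
      (∀ n, Integrable (fun y => p (h (φ n y) - h y)) μ) ∧
      Tendsto (fun n => ∫ y, p (h (φ n y) - h y) ∂μ) atTop (𝓝 0) := by
    intro p hp
    obtain ⟨M, hM⟩ := hpint p hp
    have hmeas : ∀ n, AEStronglyMeasurable (fun y => p (h (φ n y) - h y)) μ := by
      intro n
      have hc : Continuous fun q : X × X => p (h q.1 - h q.2) :=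
        hp.comp ((hh.comp continuous_fst).sub (hh.comp continuous_snd))
      exact (hc.measurable.comp ((φ n).measurable.prodMk measurable_id)).aestronglyMeasurable
    have hbd : ∀ n, ∀ᵐ y ∂μ, ‖p (h (φ n y) - h y)‖ ≤ M + M := by
      intro n
      refine ae_restrict_of_forall_mem hK.measurableSet fun y hy => ?_
      rw [Real.norm_of_nonneg (apply_nonneg p _)]
      exact (map_sub_le_add p _ _).trans (add_le_add (hM _ (hφK n y)) (hM y hy))
    refine ⟨fun n => (integrable_const (M + M)).mono' (hmeas n) (hbd n), ?_⟩
    rw [← integral_zero X ℝ (μ := μ)]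
    refine tendsto_integral_of_dominated_convergence (fun _ => M + M) hmeas (integrable_const _)
      hbd ?_
    filter_upwards [hφlim] with y hy
    have hc : Continuous fun z => p (h z - h y) := hp.comp (hh.sub continuous_const)
    have h1 := (hc.tendsto y).comp hy
    rwa [sub_self, map_zero] at h1
  have hcauchy : CauchySeq S := by
    rw [cauchySeq_iff_tendsto, uniformity_eq_comap_nhds_zero, tendsto_comap_iff,
      (PolynormableSpace.withSeminorms 𝕜 E).tendsto_nhds]
    rintro ⟨p, hp⟩ ε hε
    obtain ⟨hi, hl⟩ := hpS p hp
    have hl2 : ∀ᶠ n in atTop, ∫ y, p (h (φ n y) - h y) ∂μ < ε / 2 :=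
      hl.eventually_lt_const (by positivity)
    rw [← prod_atTop_atTop_eq]
    filter_upwards [hl2.prod_mk hl2] with ⟨m, n⟩ ⟨hm, hn⟩
    -- Comparison of both approximants with `h` bounds `p (S n - S m)` by two integrals, each below
    -- `ε / 2`.
    have h1 := ((hS n).sub (hS m)).seminorm_le hp ((hi n).add (hi m)) (ae_of_all _ fun y => by
      have := map_sub_le_add p (h (φ n y) - h y) (h (φ m y) - h y)
      rwa [sub_sub_sub_cancel_right] at this)
    simp only [Pi.add_apply] at h1
    rw [integral_add (hi n) (hi m)] at h1
    simp only [Function.comp, Prod.map, sub_zero]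
    linarith
  obtain ⟨e, he⟩ := exists_tendsto_of_cauchySeq 𝕜 hcauchy
  refine ⟨e, fun e' => ?_⟩
  have hc : Continuous fun y => e' (h y) := e'.continuous.comp hh
  have hint : Integrable (fun y => e' (h y)) μ := hc.continuousOn.integrableOn_compact hK
  -- The scalars `e' (S n)` tend to `e' e` by continuity and to the integral of `e' ∘ h` by
  -- dominated convergence.
  refine ⟨hint, tendsto_nhds_unique ((e'.continuous.tendsto e).comp he) ?_⟩
  have h1 : ∀ n, (e' ∘ S) n = ∫ y, e' (h (φ n y)) ∂μ := fun n => (hS n e').2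
  rw [funext h1]
  obtain ⟨M, hM⟩ := (hK.image hc.norm).bddAbove
  refine tendsto_integral_of_dominated_convergence (fun _ => M)
    (fun n => (hS n e').1.aestronglyMeasurable) (integrable_const M)
    (fun n => ae_of_all _ fun y => hM ⟨_, hφK n y, rfl⟩) ?_
  filter_upwards [hφlim] with y hy
  exact (hc.tendsto y).comp hy

end WeakIntegral

/-! ### Curve derivatives and weak integrals with parameters. -/

section CurveDerivative

variable {𝕜 : Type*} [RCLike 𝕜] {E : Type*} [AddCommGroup E] [Module 𝕜 E]

/-- The curve `φ` has derivative `l` at `t`. -/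
def HasCurveDerivAt (𝕜 : Type*) [RCLike 𝕜] {E : Type*} [AddCommGroup E] [Module 𝕜 E]
    [TopologicalSpace E] (φ : ℝ → E) (l : E) (t : ℝ) : Prop :=
  Tendsto (fun h : ℝ => ((h : 𝕜)⁻¹) • (φ (t + h) - φ t)) (𝓝[≠] (0 : ℝ)) (𝓝 l)

section

variable [TopologicalSpace E]

theorem HasCurveDerivAt.hasDerivAt_dual {φ : ℝ → E} {l : E} {t : ℝ}
    (h : HasCurveDerivAt 𝕜 φ l t) (e' : StrongDual 𝕜 E) :
    HasDerivAt (fun s => e' (φ s)) (e' l) t := by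
  rw [hasDerivAt_iff_tendsto_slope_zero]
  refine ((e'.continuous.tendsto l).comp h).congr fun s => ?_
  simp [RCLike.real_smul_eq_coe_mul]

/-- The difference quotients are eventually zero and limits are unique. This keeps derivatives
inside the support of the original function. -/
theorem HasCurveDerivAt.eq_zero [T2Space E] {φ : ℝ → E} {l : E} {t : ℝ}
    (h : HasCurveDerivAt 𝕜 φ l t) (h0 : ∀ᶠ s in 𝓝 t, φ s = 0) : l = 0 := by
  refine tendsto_nhds_unique h (tendsto_const_nhds.congr' ?_)
  have h1 : Tendsto (fun s : ℝ => t + s) (𝓝 0) (𝓝 t) := by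
    simpa using (continuous_const_add t).tendsto 0
  filter_upwards [(h1.eventually h0).filter_mono nhdsWithin_le_nhds] with s hs
  rw [hs, h0.self_of_nhds, sub_zero, smul_zero]

/-- The mean value inequality with respect to a continuous seminorm. -/
theorem seminorm_sub_sub_le [PolynormableSpace 𝕜 E] {φ φ' : ℝ → E}
    (hφ : ∀ t, HasCurveDerivAt 𝕜 φ (φ' t) t) {p : Seminorm 𝕜 E} (hp : Continuous p) {ε t : ℝ}
    (hb : ∀ s, |s| ≤ |t| → p (φ' s - φ' 0) ≤ ε) :
    p (φ t - φ 0 - (t : 𝕜) • φ' 0) ≤ ε * |t| := by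
  refine seminorm_le_of_forall_dual hp fun e' he' => ?_
  -- Subtracting the linear part leaves a scalar function whose derivative is bounded by `ε` between
  -- `0` and `t`.
  have hd : ∀ s, HasDerivAt (fun s : ℝ => e' (φ s) - s • e' (φ' 0)) (e' (φ' s) - e' (φ' 0)) s := by
    intro s
    have h1 := (hasDerivAt_id s).smul_const (e' (φ' 0))
    rw [one_smul] at h1
    exact ((hφ s).hasDerivAt_dual e').sub h1
  have h2 := Convex.norm_image_sub_le_of_norm_hasDerivWithin_le (C := ε)
    (fun s _ => (hd s).hasDerivWithinAt) (s := Set.uIcc 0 t) (x := 0) (y := t)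
    (fun s hs => ?_) (convex_uIcc 0 t) Set.left_mem_uIcc Set.right_mem_uIcc
  · rw [sub_zero, Real.norm_eq_abs] at h2
    have h3 : e' (φ t - φ 0 - (t : 𝕜) • φ' 0) =
        e' (φ t) - t • e' (φ' 0) - (e' (φ 0) - (0 : ℝ) • e' (φ' 0)) := by
      rw [map_sub, map_sub, map_smul, smul_eq_mul, RCLike.real_smul_eq_coe_mul, zero_smul]
      ring
    rwa [h3]
  · rw [← map_sub]
    refine (he' _).trans (hb s ?_)
    have := Set.abs_sub_left_of_mem_uIcc hs
    simpa using this

end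

variable [TopologicalSpace E] [IsTopologicalAddGroup E]

/-- Continuous families converge uniformly on compact sets. -/
theorem eventually_forall_seminorm_sub_le {Z X : Type*} [TopologicalSpace Z] [TopologicalSpace X]
    {F : Z → X → E} (hF : Continuous (Function.uncurry F)) {K : Set X} (hK : IsCompact K) (z₀ : Z)
    {p : Seminorm 𝕜 E} (hp : Continuous p) {ε : ℝ} (hε : 0 < ε) :
    ∀ᶠ z in 𝓝 z₀, ∀ y ∈ K, p (F z y - F z₀ y) ≤ ε := by
  refine hK.eventually_forall_of_forall_eventually fun y _ => ?_
  have hc : Continuous fun q : Z × X => p (F q.1 q.2 - F z₀ q.2) :=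
    hp.comp (hF.sub (hF.comp (continuous_const.prodMk continuous_snd)))
  have h1 := hc.tendsto (z₀, y)
  simp only [sub_self, map_zero] at h1
  exact (h1.eventually_lt_const hε).mono fun _ h => h.le

variable [PolynormableSpace 𝕜 E] {X : Type*} [TopologicalSpace X] [MeasurableSpace X]
  {ν : Measure X} [IsFiniteMeasureOnCompacts ν]

/-- Weak integrals of a locally uniformly compactly supported continuous family depend
continuously on the parameter. -/
theorem continuousAt_isWeakIntegral {Z : Type*} [TopologicalSpace Z] {F : Z → X → E}
    {I : Z → E} (hF : Continuous (Function.uncurry F)) (hI : ∀ z, IsWeakIntegral 𝕜 ν (F z) (I z))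
    {z₀ : Z} {K : Set X} (hK : IsCompact K) (hKm : MeasurableSet K)
    (h0 : ∀ᶠ z in 𝓝 z₀, ∀ y ∉ K, F z y = 0) : ContinuousAt I z₀ :=
  IsWeakIntegral.tendsto hI (hI z₀) hK.measure_lt_top.ne hKm h0 h0.self_of_nhds
    fun _ hp _ hε => eventually_forall_seminorm_sub_le hF hK z₀ hp hε

/-- Differentiation under the weak integral. -/
theorem hasCurveDerivAt_isWeakIntegral [T2Space E] {F F' : ℝ → X → E} {I : ℝ → E} {I' : E}
    (hF' : Continuous (Function.uncurry F'))
    (hd : ∀ t y, HasCurveDerivAt 𝕜 (fun s => F s y) (F' t y) t)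
    (hI : ∀ t, IsWeakIntegral 𝕜 ν (F t) (I t)) (hI' : IsWeakIntegral 𝕜 ν (F' 0) I')
    {K : Set X} (hK : IsCompact K) (hKm : MeasurableSet K)
    (h0 : ∀ᶠ t in 𝓝 0, ∀ y ∉ K, F t y = 0) : HasCurveDerivAt 𝕜 I I' 0 := by
  unfold HasCurveDerivAt
  simp only [zero_add]
  refine IsWeakIntegral.tendsto (fun t => ((hI t).sub (hI 0)).const_smul ((t : 𝕜)⁻¹)) hI'
    hK.measure_lt_top.ne hKm ?_ ?_ ?_
  · filter_upwards [h0.filter_mono nhdsWithin_le_nhds] with t ht y hy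
    rw [ht y hy, h0.self_of_nhds y hy, sub_zero, smul_zero]
  · exact fun y hy => (hd 0 y).eq_zero (h0.mono fun t ht => ht y hy)
  · intro p hp ε hε
    obtain ⟨δ, hδ, hb⟩ := Metric.eventually_nhds_iff.mp
      (eventually_forall_seminorm_sub_le hF' hK 0 hp hε)
    have hδ' : ∀ᶠ t : ℝ in 𝓝[≠] 0, dist t 0 < δ :=
      (Metric.ball_mem_nhds (0 : ℝ) hδ |> Filter.Eventually.filter_mono nhdsWithin_le_nhds)
    filter_upwards [hδ', self_mem_nhdsWithin] with t ht ht0 y hy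
    have ht0 : t ≠ 0 := ht0
    -- Every `s` with `|s| ≤ |t|` also lies within `δ` of `0`, so the uniform bound on `F'` holds
    -- along the whole segment.
    have h1 := seminorm_sub_sub_le (hd · y) hp (ε := ε) (t := t) fun s hs =>
      hb (by simpa using lt_of_le_of_lt hs (by simpa using ht)) y hy
    have ht0' : (t : 𝕜) ≠ 0 := by exact_mod_cast ht0
    have h2 : (t : 𝕜)⁻¹ • (F t y - F 0 y) - F' 0 y =
        (t : 𝕜)⁻¹ • (F t y - F 0 y - (t : 𝕜) • F' 0 y) := by
      rw [smul_sub _ (F t y - F 0 y), smul_smul, inv_mul_cancel₀ ht0', one_smul]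
    rw [h2, map_smul_eq_mul, norm_inv, RCLike.norm_ofReal]
    rwa [inv_mul_le_iff₀ (abs_pos.mpr ht0), mul_comm]

end CurveDerivative

/-! ### Iterated partial derivatives and their supports. -/

section PartialDerivative

variable {𝕜 : Type*} [RCLike 𝕜] {E : Type*} [AddCommGroup E] [Module 𝕜 E] [TopologicalSpace E]
  {d : ℕ} {j : Fin d} {f : EuclideanSpace ℝ (Fin d) → E}

theorem hasPartialDerivAt_iff_hasCurveDerivAt {l : E} {x : EuclideanSpace ℝ (Fin d)} :
    HasPartialDerivAt 𝕜 j f l x ↔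
      HasCurveDerivAt 𝕜 (fun s : ℝ => f (x + s • EuclideanSpace.single j (1 : ℝ))) l 0 := by
  simp [HasPartialDerivAt, HasCurveDerivAt]

theorem HasPartialDerivAt.hasCurveDerivAt {l : E} {x : EuclideanSpace ℝ (Fin d)} {t : ℝ}
    (h : HasPartialDerivAt 𝕜 j f l (x + t • EuclideanSpace.single j (1 : ℝ))) :
    HasCurveDerivAt 𝕜 (fun s : ℝ => f (x + s • EuclideanSpace.single j (1 : ℝ))) l t := by
  simpa only [HasPartialDerivAt, HasCurveDerivAt, add_smul, add_assoc] using h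

theorem hasPartialDerivAt_partialDeriv {x : EuclideanSpace ℝ (Fin d)}
    (h : ∃ l, HasPartialDerivAt 𝕜 j f l x) :
    HasPartialDerivAt 𝕜 j f (partialDeriv 𝕜 j f x) x := by
  rw [partialDeriv, dif_pos h]
  exact h.choose_spec

theorem HasPartialDerivAt.partialDeriv_eq [T2Space E] {l : E} {x : EuclideanSpace ℝ (Fin d)}
    (h : HasPartialDerivAt 𝕜 j f l x) : partialDeriv 𝕜 j f x = l :=
  tendsto_nhds_unique (hasPartialDerivAt_partialDeriv ⟨l, h⟩) h

theorem tsupport_partialDeriv_subset [T2Space E]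
    (h : ∀ x, ∃ l, HasPartialDerivAt 𝕜 j f l x) :
    tsupport (partialDeriv 𝕜 j f) ⊆ tsupport f := by
  refine closure_minimal (fun x hx => ?_) (isClosed_tsupport f)
  by_contra hxf
  refine hx ((hasPartialDerivAt_iff_hasCurveDerivAt.mp
    (hasPartialDerivAt_partialDeriv (h x))).eq_zero ?_)
  have hc : Continuous fun s : ℝ => x + s • EuclideanSpace.single j (1 : ℝ) := by fun_prop
  have h1 := hc.tendsto 0
  simp only [zero_smul, add_zero] at h1
  filter_upwards [h1.eventually ((isClosed_tsupport f).isOpen_compl.mem_nhds hxf)] with s hs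
  exact image_eq_zero_of_notMem_tsupport hs

theorem _root_.HasCompactSupport.partialDeriv [T2Space E] (hf : HasCompactSupport f)
    (h : ∀ x, ∃ l, HasPartialDerivAt 𝕜 j f l x) :
    HasCompactSupport (PettisConv.partialDeriv 𝕜 j f) :=
  hf.of_isClosed_subset (isClosed_tsupport _) (tsupport_partialDeriv_subset h)

variable (𝕜) in
/-- Partial derivatives taken successively along a list of directions. -/
noncomputable def listDeriv (L : List (Fin d)) (f : EuclideanSpace ℝ (Fin d) → E) :
    EuclideanSpace ℝ (Fin d) → E :=
  L.foldr (partialDeriv 𝕜) f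

/-- A list of single directions lets inductions peel off one derivative at a time. The order is
preserved, so no symmetry of mixed partials is needed. -/
theorem multiDeriv_eq_listDeriv (β : Fin d → ℕ) (f : EuclideanSpace ℝ (Fin d) → E) :
    multiDeriv 𝕜 β f =
      listDeriv 𝕜 ((List.finRange d).flatMap fun j => List.replicate (β j) j) f := by
  have h1 : ∀ (m : ℕ) (j : Fin d) (F : EuclideanSpace ℝ (Fin d) → E),
      (partialDeriv 𝕜 j)^[m] F = (List.replicate m j).foldr (partialDeriv 𝕜) F := by
    intro m j F
    induction m with
    | zero => rfl
    | succ m ih => rw [Function.iterate_succ_apply', ih, List.replicate_succ, List.foldr_cons]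
  unfold multiDeriv listDeriv
  induction List.finRange d with
  | nil => rfl
  | cons j L ih => rw [List.foldr_cons, ih, h1, List.flatMap_cons, List.foldr_append]

theorem length_flatMap_replicate (β : Fin d → ℕ) :
    ((List.finRange d).flatMap fun j => List.replicate (β j) j).length = ∑ j, β j := by
  simp [List.length_flatMap, Fin.sum_univ_def]

theorem IsCNat.listDeriv {L : List (Fin d)} {m : ℕ} (h : IsCNat 𝕜 (L.length + m) f) :
    IsCNat 𝕜 m (listDeriv 𝕜 L f) := by
  induction L generalizing m with
  | nil => simpa [PettisConv.listDeriv] using h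
  | cons j L ih =>
    have h1 : IsCNat 𝕜 (m + 1) (PettisConv.listDeriv 𝕜 L f) := ih (by
      convert h using 1
      simp only [List.length_cons]
      ring)
    exact (h1.2 j).2

theorem IsC.mono {k n : ℕ∞} (h : IsC 𝕜 k f) (hn : n ≤ k) : IsC 𝕜 n f :=
  fun m hm => h m (hm.trans hn)

theorem IsC.continuous {k : ℕ∞} (h : IsC 𝕜 k f) : Continuous f := h 0 (by simp)

theorem IsC.continuous_listDeriv {L : List (Fin d)} (h : IsC 𝕜 L.length f) :
    Continuous (listDeriv 𝕜 L f) :=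
  IsCNat.listDeriv (m := 0) (h _ le_rfl)

theorem IsC.isCNat_one_listDeriv {j : Fin d} {L : List (Fin d)} (h : IsC 𝕜 (j :: L).length f) :
    IsCNat 𝕜 1 (PettisConv.listDeriv 𝕜 L f) :=
  IsCNat.listDeriv (h _ le_rfl)

theorem IsC.of_cons {j : Fin d} {L : List (Fin d)} (h : IsC 𝕜 (j :: L).length f) :
    IsC 𝕜 L.length f :=
  h.mono (by exact_mod_cast Nat.le_succ _)

theorem tsupport_listDeriv_subset [T2Space E] {L : List (Fin d)} (h : IsC 𝕜 L.length f) :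
    tsupport (listDeriv 𝕜 L f) ⊆ tsupport f := by
  induction L with
  | nil => exact subset_rfl
  | cons j L ih =>
    exact (tsupport_partialDeriv_subset (h.isCNat_one_listDeriv.1 j)).trans (ih h.of_cons)

theorem _root_.HasCompactSupport.listDeriv [T2Space E] (hf : HasCompactSupport f)
    {L : List (Fin d)} (h : IsC 𝕜 L.length f) :
    HasCompactSupport (PettisConv.listDeriv 𝕜 L f) :=
  hf.of_isClosed_subset (isClosed_tsupport _) (tsupport_listDeriv_subset h)

end PartialDerivative

/-! ### Compact supports of the convolution integrands. -/

section Convolution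

variable {𝕜 : Type*} [RCLike 𝕜] {E : Type*} [AddCommGroup E] [Module 𝕜 E] {d : ℕ}

/-- The integrands of `f ∗ g` have locally uniformly compact support. -/
theorem exists_isCompact_integrandVS [TopologicalSpace E] {f : EuclideanSpace ℝ (Fin d) → E}
    {g : EuclideanSpace ℝ (Fin d) → 𝕜} (h : HasCompactSupport f ∨ HasCompactSupport g)
    (x₀ : EuclideanSpace ℝ (Fin d)) :
    ∃ K, IsCompact K ∧ ∀ᶠ x in 𝓝 x₀, ∀ y ∉ K, integrandVS 𝕜 f g x y = 0 := by
  rcases h with h | h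
  · refine ⟨tsupport f, h, Eventually.of_forall fun x y hy => ?_⟩
    rw [integrandVS, image_eq_zero_of_notMem_tsupport hy, smul_zero]
  · refine ⟨(fun q => q.1 - q.2) '' (Metric.closedBall x₀ 1 ×ˢ tsupport g),
      ((isCompact_closedBall x₀ 1).prod h).image continuous_sub, ?_⟩
    filter_upwards [Metric.closedBall_mem_nhds x₀ one_pos] with x hx y hy
    have hxy : x - y ∉ tsupport g := fun hxy => hy ⟨(x, x - y), ⟨hx, hxy⟩, sub_sub_cancel x y⟩
    rw [integrandVS, image_eq_zero_of_notMem_tsupport hxy, zero_smul]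

/-- The integrands of `g ∗ f` have locally uniformly compact support. -/
theorem exists_isCompact_integrandSV [TopologicalSpace E] {f : EuclideanSpace ℝ (Fin d) → E}
    {g : EuclideanSpace ℝ (Fin d) → 𝕜} (h : HasCompactSupport f ∨ HasCompactSupport g)
    (x₀ : EuclideanSpace ℝ (Fin d)) :
    ∃ K, IsCompact K ∧ ∀ᶠ x in 𝓝 x₀, ∀ y ∉ K, integrandSV 𝕜 g f x y = 0 := by
  rcases h with h | h
  · refine ⟨(fun q => q.1 - q.2) '' (Metric.closedBall x₀ 1 ×ˢ tsupport f),
      ((isCompact_closedBall x₀ 1).prod h).image continuous_sub, ?_⟩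
    filter_upwards [Metric.closedBall_mem_nhds x₀ one_pos] with x hx y hy
    have hxy : x - y ∉ tsupport f := fun hxy => hy ⟨(x, x - y), ⟨hx, hxy⟩, sub_sub_cancel x y⟩
    rw [integrandSV, image_eq_zero_of_notMem_tsupport hxy, smul_zero]
  · refine ⟨tsupport g, h, Eventually.of_forall fun x y hy => ?_⟩
    rw [integrandSV, image_eq_zero_of_notMem_tsupport hy, zero_smul]

end Convolution

/-! ### Existence, support, symmetry and derivatives of convolutions. -/

section Convolution

variable {𝕜 : Type*} [RCLike 𝕜] {E : Type*} [AddCommGroup E] [Module 𝕜 E] {d : ℕ}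

section

variable [TopologicalSpace E] [ContinuousSMul 𝕜 E]
  {f : EuclideanSpace ℝ (Fin d) → E} {g : EuclideanSpace ℝ (Fin d) → 𝕜}

theorem continuous_integrandVS (hf : Continuous f) (hg : Continuous g) :
    Continuous (Function.uncurry (integrandVS 𝕜 f g)) :=
  (hg.comp (continuous_fst.sub continuous_snd)).smul (hf.comp continuous_snd)

theorem continuous_integrandSV (hf : Continuous f) (hg : Continuous g) :
    Continuous (Function.uncurry (integrandSV 𝕜 g f)) :=
  (hg.comp continuous_snd).smul (hf.comp (continuous_fst.sub continuous_snd))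

theorem hasCurveDerivAt_integrandVS {g' : EuclideanSpace ℝ (Fin d) → 𝕜} {j : Fin d}
    (hg : ∀ x, HasPartialDerivAt 𝕜 j g (g' x) x) (x y : EuclideanSpace ℝ (Fin d)) (t : ℝ) :
    HasCurveDerivAt 𝕜
      (fun s : ℝ => integrandVS 𝕜 f g (x + s • EuclideanSpace.single j (1 : ℝ)) y)
      (integrandVS 𝕜 f g' (x + t • EuclideanSpace.single j (1 : ℝ)) y) t := by
  have h1 := (hg (x - y + t • EuclideanSpace.single j (1 : ℝ))).hasCurveDerivAt
  -- Moving `x` along `e_j` moves the argument `x - y` of `g` along `e_j`.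
  simp only [integrandVS, add_sub_right_comm]
  refine (h1.smul_const (f y)).congr fun s => ?_
  rw [smul_assoc, sub_smul]

theorem hasCurveDerivAt_integrandSV {f' : EuclideanSpace ℝ (Fin d) → E} {j : Fin d}
    (hf : ∀ x, HasPartialDerivAt 𝕜 j f (f' x) x) (x y : EuclideanSpace ℝ (Fin d)) (t : ℝ) :
    HasCurveDerivAt 𝕜
      (fun s : ℝ => integrandSV 𝕜 g f (x + s • EuclideanSpace.single j (1 : ℝ)) y)
      (integrandSV 𝕜 g f' (x + t • EuclideanSpace.single j (1 : ℝ)) y) t := by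
  have h1 := (hf (x - y + t • EuclideanSpace.single j (1 : ℝ))).hasCurveDerivAt
  simp only [integrandSV, add_sub_right_comm]
  refine (Tendsto.const_smul h1 (g y)).congr fun s => ?_
  rw [smul_comm, smul_sub (g y)]

end

variable [UniformSpace E] [IsUniformAddGroup E] [ContinuousSMul 𝕜 E] [T2Space E]
  [PolynormableSpace 𝕜 E] [QuasiCompleteSpace 𝕜 E]

omit [T2Space E] in
theorem pettisIntegrable_of_continuous {h : EuclideanSpace ℝ (Fin d) → E} (hh : Continuous h)
    {K : Set (EuclideanSpace ℝ (Fin d))} (hK : IsCompact K) (h0 : ∀ y ∉ K, h y = 0) :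
    PettisIntegrable 𝕜 volume h := by
  intro Λ _
  refine ⟨fun e' => (e'.continuous.comp hh).measurable.nullMeasurable, ?_⟩
  -- Passing to the restricted measure leaves `h` continuous; multiplying by an indicator would not.
  obtain ⟨e, he⟩ := exists_isWeakIntegral (𝕜 := 𝕜) (ν := volume.restrict Λ) hh hK h0
  exact ⟨fun e' => (he e').1, e, fun e' => (he e').2⟩

omit [IsUniformAddGroup E] [ContinuousSMul 𝕜 E] [T2Space E] [PolynormableSpace 𝕜 E]
  [QuasiCompleteSpace 𝕜 E] in
theorem PettisIntegrable.isWeakIntegral {h : EuclideanSpace ℝ (Fin d) → E}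
    (hh : PettisIntegrable 𝕜 volume h) :
    IsWeakIntegral 𝕜 volume h (pettisIntegral 𝕜 volume Set.univ h) := by
  intro e'
  have h1 := hh Set.univ nullMeasurableSet_univ
  have h2 := h1.2.1 e'
  rw [integrableOn_univ] at h2
  refine ⟨h2, ?_⟩
  rw [pettisIntegral, dif_pos h1, h1.2.2.choose_spec e', setIntegral_univ]

omit [QuasiCompleteSpace 𝕜 E] in
theorem PettisIntegrable.pettisIntegral_eq_of_isWeakIntegral {h : EuclideanSpace ℝ (Fin d) → E}
    (hh : PettisIntegrable 𝕜 volume h) {e : E} (he : IsWeakIntegral 𝕜 volume h e) :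
    pettisIntegral 𝕜 volume Set.univ h = e :=
  pettisIntegral_eq 𝕜 (hh Set.univ nullMeasurableSet_univ) fun e' => by
    rw [(he e').2, setIntegral_univ]

variable {f f' : EuclideanSpace ℝ (Fin d) → E} {g g' : EuclideanSpace ℝ (Fin d) → 𝕜}

omit [T2Space E] in
theorem convVSExists_of_continuous (hf : Continuous f) (hg : Continuous g)
    (h : HasCompactSupport f ∨ HasCompactSupport g) : ConvVSExists 𝕜 f g := by
  intro x
  obtain ⟨K, hK, h0⟩ := exists_isCompact_integrandVS h x
  exact pettisIntegrable_of_continuous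
    ((continuous_integrandVS hf hg).comp (continuous_const.prodMk continuous_id)) hK
    h0.self_of_nhds

omit [T2Space E] in
theorem convSVExists_of_continuous (hf : Continuous f) (hg : Continuous g)
    (h : HasCompactSupport f ∨ HasCompactSupport g) : ConvSVExists 𝕜 g f := by
  intro x
  obtain ⟨K, hK, h0⟩ := exists_isCompact_integrandSV h x
  exact pettisIntegrable_of_continuous
    ((continuous_integrandSV hf hg).comp (continuous_const.prodMk continuous_id)) hK
    h0.self_of_nhds

omit [QuasiCompleteSpace 𝕜 E] in
-- After applying a functional, this is invariance of Lebesgue measure under `y ↦ x - y`; uniqueness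
-- of the Pettis integral lifts it to `E`.
theorem convVS_eq_convSV (hVS : ConvVSExists 𝕜 f g) (hSV : ConvSVExists 𝕜 g f) :
    convVS 𝕜 f g = convSV 𝕜 g f := by
  funext x
  refine (hVS x).pettisIntegral_eq_of_isWeakIntegral fun e' => ⟨((hVS x).isWeakIntegral e').1, ?_⟩
  rw [convSV, ((hSV x).isWeakIntegral e').2,
    ← integral_sub_left_eq_self (fun y => e' (integrandVS 𝕜 f g x y)) volume x]
  simp only [integrandVS, integrandSV, sub_sub_cancel]

omit [QuasiCompleteSpace 𝕜 E] in
theorem tsupport_convVS_subset (hfg : ConvVSExists 𝕜 f g)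
    (h : HasCompactSupport f ∨ HasCompactSupport g) :
    tsupport (convVS 𝕜 f g) ⊆ tsupport f + tsupport g := by
  refine closure_minimal (fun x hx => ?_) ?_
  · by_contra hx'
    refine hx ((hfg x).pettisIntegral_eq_of_isWeakIntegral fun e' => ?_)
    have h0 : ∀ y, integrandVS 𝕜 f g x y = 0 := by
      intro y
      by_cases hy : y ∈ tsupport f
      · have hxy : x - y ∉ tsupport g := fun hxy => hx' ⟨y, hy, x - y, hxy, add_sub_cancel y x⟩
        rw [integrandVS, image_eq_zero_of_notMem_tsupport hxy, zero_smul]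
      · rw [integrandVS, image_eq_zero_of_notMem_tsupport hy, smul_zero]
    simp [h0]
  -- The sum of a compact and a closed set is closed, so no closure of the sum is needed.
  · rcases h with h | h
    · exact (isClosed_tsupport g).add_left_of_isCompact h
    · exact (isClosed_tsupport f).add_right_of_isCompact h

omit [T2Space E] in
theorem continuous_convVS (hf : Continuous f) (hg : Continuous g)
    (h : HasCompactSupport f ∨ HasCompactSupport g) : Continuous (convVS 𝕜 f g) := by
  refine continuous_iff_continuousAt.mpr fun x => ?_
  obtain ⟨K, hK, h0⟩ := exists_isCompact_integrandVS h x
  exact continuousAt_isWeakIntegral (continuous_integrandVS hf hg)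
    (fun x => (convVSExists_of_continuous hf hg h x).isWeakIntegral) hK hK.measurableSet h0

theorem hasPartialDerivAt_convVS {j : Fin d} (hf : Continuous f) (hg : Continuous g)
    (hg' : Continuous g') (hd : ∀ x, HasPartialDerivAt 𝕜 j g (g' x) x)
    (h : HasCompactSupport f ∨ HasCompactSupport g)
    (h' : HasCompactSupport f ∨ HasCompactSupport g') (x : EuclideanSpace ℝ (Fin d)) :
    HasPartialDerivAt 𝕜 j (convVS 𝕜 f g) (convVS 𝕜 f g' x) x := by
  rw [hasPartialDerivAt_iff_hasCurveDerivAt]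
  obtain ⟨K, hK, h0⟩ := exists_isCompact_integrandVS h x
  have hc : Continuous fun s : ℝ => x + s • EuclideanSpace.single j (1 : ℝ) := by fun_prop
  have hx : x + (0 : ℝ) • EuclideanSpace.single j (1 : ℝ) = x := by simp
  refine hasCurveDerivAt_isWeakIntegral (ν := volume)
    (F' := fun t => integrandVS 𝕜 f g' (x + t • EuclideanSpace.single j (1 : ℝ)))
    ((continuous_integrandVS hf hg').comp ((hc.comp continuous_fst).prodMk continuous_snd))
    (fun t y => hasCurveDerivAt_integrandVS hd x y t)
    (fun t => (convVSExists_of_continuous hf hg h _).isWeakIntegral) ?_ hK hK.measurableSet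
    ((hc.tendsto' 0 x hx).eventually h0)
  rw [hx]
  exact (convVSExists_of_continuous hf hg' h' x).isWeakIntegral

theorem hasPartialDerivAt_convSV {j : Fin d} (hf : Continuous f) (hg : Continuous g)
    (hf' : Continuous f') (hd : ∀ x, HasPartialDerivAt 𝕜 j f (f' x) x)
    (h : HasCompactSupport f ∨ HasCompactSupport g)
    (h' : HasCompactSupport f' ∨ HasCompactSupport g) (x : EuclideanSpace ℝ (Fin d)) :
    HasPartialDerivAt 𝕜 j (convSV 𝕜 g f) (convSV 𝕜 g f' x) x := by
  rw [hasPartialDerivAt_iff_hasCurveDerivAt]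
  obtain ⟨K, hK, h0⟩ := exists_isCompact_integrandSV h x
  have hc : Continuous fun s : ℝ => x + s • EuclideanSpace.single j (1 : ℝ) := by fun_prop
  have hx : x + (0 : ℝ) • EuclideanSpace.single j (1 : ℝ) = x := by simp
  refine hasCurveDerivAt_isWeakIntegral (ν := volume)
    (F' := fun t => integrandSV 𝕜 g f' (x + t • EuclideanSpace.single j (1 : ℝ)))
    ((continuous_integrandSV hf' hg).comp ((hc.comp continuous_fst).prodMk continuous_snd))
    (fun t y => hasCurveDerivAt_integrandSV hd x y t)
    (fun t => (convSVExists_of_continuous hf hg h _).isWeakIntegral) ?_ hK hK.measurableSet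
    ((hc.tendsto' 0 x hx).eventually h0)
  rw [hx]
  exact (convSVExists_of_continuous hf' hg h' x).isWeakIntegral

/-- Each derivative replaces `g` by a partial derivative, so the induction varies `g`. Continuity of
`g` is carried along because `IsCNat` of positive order only records conditions on the partial
derivatives. -/
theorem isCNat_convVS (hf : Continuous f) {m : ℕ} (hg : Continuous g) (hgm : IsCNat 𝕜 m g)
    (h : HasCompactSupport f ∨ HasCompactSupport g) : IsCNat 𝕜 m (convVS 𝕜 f g) := by
  induction m generalizing g with
  | zero => exact continuous_convVS hf hg h
  | succ m ih =>
    have h' : ∀ j, HasCompactSupport f ∨ HasCompactSupport (partialDeriv 𝕜 j g) := fun j =>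
      h.imp_right fun hs => hs.partialDeriv (hgm.1 j)
    have hd : ∀ j x, HasPartialDerivAt 𝕜 j (convVS 𝕜 f g) (convVS 𝕜 f (partialDeriv 𝕜 j g) x) x :=
      fun j => hasPartialDerivAt_convVS hf hg (hgm.2 j).1
        (fun x => hasPartialDerivAt_partialDeriv (hgm.1 j x)) h (h' j)
    refine ⟨fun j x => ⟨_, hd j x⟩, fun j => ?_⟩
    rw [funext fun x => (hd j x).partialDeriv_eq]
    exact ⟨continuous_convVS hf (hgm.2 j).1 (h' j), ih (hgm.2 j).1 (hgm.2 j).2 (h' j)⟩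

theorem listDeriv_convVS_right (hf : Continuous f) {L : List (Fin d)} (hg : IsC 𝕜 L.length g)
    (h : HasCompactSupport f ∨ HasCompactSupport g) :
    listDeriv 𝕜 L (convVS 𝕜 f g) = convVS 𝕜 f (listDeriv 𝕜 L g) := by
  induction L with
  | nil => rfl
  | cons j L ih =>
    have hg' := hg.of_cons
    change partialDeriv 𝕜 j (listDeriv 𝕜 L (convVS 𝕜 f g)) = _
    rw [ih hg']
    exact funext fun x => (hasPartialDerivAt_convVS hf hg'.continuous_listDeriv
      hg.continuous_listDeriv
      (fun x => hasPartialDerivAt_partialDeriv (hg.isCNat_one_listDeriv.1 j x))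
      (h.imp_right fun hs => hs.listDeriv hg') (h.imp_right fun hs => hs.listDeriv hg)
      x).partialDeriv_eq

theorem listDeriv_convSV_right (hg : Continuous g) {L : List (Fin d)} (hf : IsC 𝕜 L.length f)
    (h : HasCompactSupport f ∨ HasCompactSupport g) :
    listDeriv 𝕜 L (convSV 𝕜 g f) = convSV 𝕜 g (listDeriv 𝕜 L f) := by
  induction L with
  | nil => rfl
  | cons j L ih =>
    have hf' := hf.of_cons
    change partialDeriv 𝕜 j (listDeriv 𝕜 L (convSV 𝕜 g f)) = _
    rw [ih hf']
    exact funext fun x => (hasPartialDerivAt_convSV hf'.continuous_listDeriv hg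
      hf.continuous_listDeriv
      (fun x => hasPartialDerivAt_partialDeriv (hf.isCNat_one_listDeriv.1 j x))
      (h.imp_left fun hs => hs.listDeriv hf') (h.imp_left fun hs => hs.listDeriv hf)
      x).partialDeriv_eq

end Convolution

end PettisConv

theorem mainTheorem4 {𝕜 : Type*} [RCLike 𝕜] {E : Type*} [AddCommGroup E] [Module 𝕜 E]
    [UniformSpace E] [IsUniformAddGroup E] [ContinuousSMul 𝕜 E] [T2Space E]
    [PolynormableSpace 𝕜 E] [QuasiCompleteSpace 𝕜 E]
    {d : ℕ} (k n : ℕ∞)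
    (f : EuclideanSpace ℝ (Fin d) → E) (g : EuclideanSpace ℝ (Fin d) → 𝕜)
    (hf : PettisConv.IsC 𝕜 k f) (hg : PettisConv.IsC 𝕜 n g)
    (hsupp : HasCompactSupport f ∨ HasCompactSupport g) :
    PettisConv.ConvVSExists 𝕜 f g ∧
    PettisConv.ConvSVExists 𝕜 g f ∧
    tsupport (PettisConv.convVS 𝕜 f g) ⊆ tsupport f + tsupport g ∧
    PettisConv.convVS 𝕜 f g = PettisConv.convSV 𝕜 g f ∧
    PettisConv.IsC 𝕜 n (PettisConv.convVS 𝕜 f g) ∧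
    (∀ β : Fin d → ℕ, ((∑ j, β j : ℕ) : ℕ∞) ≤ n →
      PettisConv.ConvVSExists 𝕜 f (PettisConv.multiDeriv 𝕜 β g) ∧
      PettisConv.multiDeriv 𝕜 β (PettisConv.convVS 𝕜 f g) =
        PettisConv.convVS 𝕜 f (PettisConv.multiDeriv 𝕜 β g)) ∧
    (∀ β : Fin d → ℕ, ((∑ j, β j : ℕ) : ℕ∞) ≤ min k n →
      PettisConv.ConvVSExists 𝕜 (PettisConv.multiDeriv 𝕜 β f) g ∧
      PettisConv.multiDeriv 𝕜 β (PettisConv.convVS 𝕜 f g) =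
        PettisConv.convVS 𝕜 (PettisConv.multiDeriv 𝕜 β f) g) := by
  have hfc := hf.continuous
  have hgc := hg.continuous
  have hVS := PettisConv.convVSExists_of_continuous hfc hgc hsupp
  have hSV := PettisConv.convSVExists_of_continuous hfc hgc hsupp
  refine ⟨hVS, hSV, PettisConv.tsupport_convVS_subset hVS hsupp,
    PettisConv.convVS_eq_convSV hVS hSV,
    fun m hm => PettisConv.isCNat_convVS hfc hgc (hg m hm) hsupp, fun β hβ => ?_, fun β hβ => ?_⟩
  · rw [← PettisConv.length_flatMap_replicate] at hβ
    have hgβ := hg.mono hβ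
    simp only [PettisConv.multiDeriv_eq_listDeriv]
    exact ⟨PettisConv.convVSExists_of_continuous hfc hgβ.continuous_listDeriv
      (hsupp.imp_right fun hs => hs.listDeriv hgβ),
      PettisConv.listDeriv_convVS_right hfc hgβ hsupp⟩
  · rw [← PettisConv.length_flatMap_replicate] at hβ
    have hfβ := hf.mono (hβ.trans (min_le_left k n))
    have hsupp' := hsupp.imp_left fun hs => hs.listDeriv hfβ
    simp only [PettisConv.multiDeriv_eq_listDeriv]
    have hVS' := PettisConv.convVSExists_of_continuous hfβ.continuous_listDeriv hgc hsupp'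
    refine ⟨hVS', ?_⟩
    -- Both sides are rewritten in the order `g ∗ f`, where `x` enters through `f` and derivatives
    -- fall on it.
    rw [PettisConv.convVS_eq_convSV hVS hSV, PettisConv.convVS_eq_convSV hVS'
      (PettisConv.convSVExists_of_continuous hfβ.continuous_listDeriv hgc hsupp')]
    exact PettisConv.listDeriv_convSV_right hgc hfβ hsupp
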